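/- **Model.** Two senders $i\in\{1,2\}$ have independent types $\omega_i\in\{0,1\}$ with $\Pr(\omega_i=1)=\mu$. Each sender $i$ simultaneously commits to an experiment, i.e. a Borel probability measure $p_i$ on $[0,1]$ (a distribution of posteriors) with mean $\mu$. The receiver $R$ does not observe $p_i$ until she visits sender $i$. She chooses whether to visit a sender and, if so, whom to visit first (she may randomize over the order). At the first sender visited, $i$, she observes $p_i$ and chooses a garbling $q_i$ of it (a distribution with the same mean that second-order stochastically dominates $p_i$), at attention cost $\int k(x-\mu)^2\,dq_i(x)$, and draws a posterior $x$ from $q_i$. Depending on $x$ she may then visit the other sender $j$, observe $p_j$, choose a garbling $q_j$ of it (which may depend on $x$) at cost $\int k(y-\mu)^2\,dq_j(y)$, and draw $y$ from $q_j$. The posterior about a sender who is not visited is $\mu$. She selects the sender with the higher posterior (ties broken in any way). $R$'s payoff is the posterior of the selected sender minus attention costs; a sender's payoff is the probability of being selected. $R$'s strategy is pure except for the order of visits and ties, and her second-stage behaviour is a measurable function of $x$. A profile $(p_1,p_2,\sigma)$ is a (subgame perfect) equilibrium if $R$'s behaviour $\sigma$ is optimal wherever she moves, after every observed offer and every drawn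 belief, given that a sender not yet visited is expected to make his equilibrium offer, and no sender gains by unilaterally changing his experiment (which $R$ discovers only on visiting him). The outcome of a profile is the joint law of: the sender visited first (if any), the final posteriors about both senders, whether a second visit takes place, and the selected sender. Two profiles are outcome-equivalent if these laws coincide. Full information is the distribution on $\{0,1\}$ with mean $\mu$. **Claim.** Let $k>\tfrac12$ and $\mu\in\left[\tfrac1{4k},\,1-\tfrac1{4k}\right]$. For $i\in\{1,2\}$ let $p_i$ be any distribution on $[0,1]$ with mean $\mu$ of which the distribution putting probability $\tfrac12$ on each of $\mu-\tfrac1{4k}$ and $\mu+\tfrac1{4k}$ is a garbling. Then: 1. There is an equilibrium in which sender $i$ offers $p_i$, $i=1,2$. More precisely, for every lottery $w$ over the two senders there is a strategy $\sigma$ of $R$ that forms an equilibrium both with the offers $(p_1,p_2)$ and with full information from both senders, and in both cases the outcome is the following: $R$ visits only one sender, drawn from $w$; the posterior about him is $\mu\pm\tfrac1{4k}$ with probability $\tfrac12$ each; she selects him if it is $\mu+\tfrac1{4k}$ and the other sender if it is $\mu-\tfrac1{4k}$. 2. Every equilibrium in which sender $i$ offers $p_i$, $i=1,2$, is outcome-equivalent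 to an equilibrium in which both senders offer full information. -/

import Mathlib

open MeasureTheory Set

noncomputable section

namespace Disclosure

/-- A (Bayes-plausible) distribution of posterior beliefs: a Borel probability measure on `[0,1]`
with mean the prior `μ`. -/
structure Experiment (μ : ℝ) where
  law : Measure ℝ
  isProb : IsProbabilityMeasure law
  supported : law (Icc 0 1)ᶜ = 0
  mean_eq : ∫ x, x ∂law = μ

/-- The law with mean `μ` carried by the two points `a < b`. -/
def twoPointLaw (μ a b : ℝ) : Measure ℝ :=
  ENNReal.ofReal ((b - μ) / (b - a)) • Measure.dirac a +
    ENNReal.ofReal ((μ - a) / (b - a)) • Measure.dirac b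

/-- The experiment with prior `μ` whose posteriors are the two points `a < b`. -/
def Experiment.twoPoint (μ a b : ℝ) (h0 : 0 ≤ a) (ha : a ≤ μ) (hb : μ ≤ b) (h1 : b ≤ 1)
    (hab : a < b) : Experiment μ where
  law := twoPointLaw μ a b
  isProb := by
    have hne : b - a ≠ 0 := by linarith
    refine ⟨?_⟩
    simp only [twoPointLaw, Measure.add_apply, Measure.smul_apply, measure_univ, smul_eq_mul,
      mul_one]
    rw [← ENNReal.ofReal_add (div_nonneg (by linarith) (by linarith))
      (div_nonneg (by linarith) (by linarith)), ← add_div]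
    have : b - μ + (μ - a) = b - a := by ring
    rw [this, div_self hne, ENNReal.ofReal_one]
  supported := by
    have m : MeasurableSet (Icc (0 : ℝ) 1)ᶜ := measurableSet_Icc.compl
    have ha' : a ∈ Icc (0 : ℝ) 1 := ⟨h0, by linarith⟩
    have hb' : b ∈ Icc (0 : ℝ) 1 := ⟨by linarith, h1⟩
    simp only [twoPointLaw, Measure.add_apply, Measure.smul_apply, Measure.dirac_apply' _ m]
    simp [ha'.1, ha'.2, hb'.1, hb'.2]
  mean_eq := by
    have hne : b - a ≠ 0 := by linarith
    have i : ∀ c d : ℝ, Integrable (fun x : ℝ => x) (ENNReal.ofReal c • Measure.dirac d) :=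
      fun c d => (integrable_dirac (by simp)).smul_measure ENNReal.ofReal_ne_top
    rw [twoPointLaw, integral_add_measure (i _ _) (i _ _), integral_smul_measure,
      integral_smul_measure, integral_dirac, integral_dirac,
      ENNReal.toReal_ofReal (div_nonneg (by linarith) (by linarith)),
      ENNReal.toReal_ofReal (div_nonneg (by linarith) (by linarith)), smul_eq_mul, smul_eq_mul]
    field_simp
    ring

/-- Full information: the posterior is `0` or `1`. -/
def Experiment.full (μ : ℝ) (hμ : μ ∈ Icc (0 : ℝ) 1) : Experiment μ :=
  .twoPoint μ 0 1 le_rfl hμ.1 hμ.2 le_rfl one_pos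

/-- `q` is a garbling (mean preserving contraction) of `p`: equal means, and `q` dominates `p` in
second order, i.e. every nondecreasing concave utility prefers `q` to `p`. -/
def IsGarbling (q p : Measure ℝ) : Prop :=
  ∫ x, x ∂q = ∫ x, x ∂p ∧
    ∀ u : ℝ → ℝ, Monotone u → ConcaveOn ℝ univ u → ∫ x, u x ∂p ≤ ∫ x, u x ∂q

/-- The other sender. -/
def other (i : Fin 2) : Fin 2 := 1 - i

/-- A strategy of the receiver. Pure, except for the order of visits (and the selection between
senders with equal posteriors). In every field, the first argument of type `Fin 2` is
the sender visited first. -/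
structure Strategy (μ : ℝ) where
  /-- Visit nobody, or draw the sender visited first from a lottery. -/
  order : Option (PMF (Fin 2))
  /-- The garbling of the distribution found at the sender visited first. -/
  garble₁ : Fin 2 → Experiment μ → Experiment μ
  garble₁_isGarbling : ∀ i p, IsGarbling (garble₁ i p).law p.law
  /-- The beliefs drawn at the first visit after which the second sender is visited. -/
  visit : Fin 2 → Set ℝ
  measurableSet_visit : ∀ i, MeasurableSet (visit i)
  /-- The garbling of the distribution found at the second sender, after the first belief. -/
  garble₂ : Fin 2 → ℝ → Experiment μ → Experiment μ
  garble₂_isGarbling : ∀ i x p, IsGarbling (garble₂ i x p).law p.law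
  measurable_garble₂ : ∀ i p, Measurable fun x => (garble₂ i x p).law
  /-- The probability of selecting the sender visited first when both posteriors equal `x`. -/
  tie : Fin 2 → ℝ → unitInterval
  measurable_tie : ∀ i, Measurable (tie i)
  /-- The lottery that selects a sender when nobody is visited. -/
  idle : PMF (Fin 2)

variable {μ : ℝ}

/-- The probability of selecting the sender `i` visited first, at final posteriors `x` about him
and `y` about the other sender. The higher posterior is selected. -/
def Strategy.selectFirst (σ : Strategy μ) (i : Fin 2) (x y : ℝ) : ℝ :=
  if y < x then 1 else if x < y then 0 else σ.tie i x

/-- What happens in a play: the sender visited first (if any), the final posteriors about the two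
senders, whether a second visit took place, and the selected sender. -/
abbrev Outcome : Type := Option (Fin 2) × (Fin 2 → ℝ) × Bool × Fin 2

instance : MeasurableSpace (Option (Fin 2)) := ⊤

/-- Posteriors `x` about sender `i` and `y` about the other one. -/
def beliefs (i : Fin 2) (x y : ℝ) : Fin 2 → ℝ := fun j => if j = i then x else y

/-- The law of the outcome when `i` was visited first, the final posteriors are `x` about him and
`y` about the other sender, and `b` tells whether the latter was visited. -/
def Strategy.select (σ : Strategy μ) (i : Fin 2) (x y : ℝ) (b : Bool) : Measure Outcome :=
  ENNReal.ofReal (σ.selectFirst i x y) • Measure.dirac (some i, beliefs i x y, b, i) +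
    ENNReal.ofReal (1 - σ.selectFirst i x y) •
      Measure.dirac (some i, beliefs i x y, b, other i)

/-- The law of the outcome conditional on `i` being visited first. A sender who is not visited
keeps the posterior `μ`. -/
def outcomeFrom (p : Fin 2 → Experiment μ) (σ : Strategy μ) (i : Fin 2) : Measure Outcome :=
  open Classical in
  (σ.garble₁ i (p i)).law.bind fun x =>
    if x ∈ σ.visit i then
      (σ.garble₂ i x (p (other i))).law.bind fun y => σ.select i x y true
    else σ.select i x μ false

/-- The law of the outcome when sender `i` offers `p i` and the receiver plays `σ`. -/
def outcome (p : Fin 2 → Experiment μ) (σ : Strategy μ) : Measure Outcome :=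
  match σ.order with
  | none => ∑ s, σ.idle s • Measure.dirac (none, fun _ => μ, false, s)
  | some w => ∑ i, w i • outcomeFrom p σ i

/-- A sender's payoff: the probability of being selected. -/
def senderPayoff (p : Fin 2 → Experiment μ) (σ : Strategy μ) (i : Fin 2) : ℝ :=
  (outcome p σ).real {o | o.2.2.2 = i}

/-- The receiver's expected payoff from garbling the second sender's distribution to `q` at first
belief `x`, net of the attention cost of `q` with cost parameter `k`. -/
def stage2Payoff (k x : ℝ) (q : Experiment μ) : ℝ :=
  ∫ y, (max x y - k * (y - μ) ^ 2) ∂q.law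

/-- The receiver's payoff after the belief `x` drawn from the sender `i` visited first, if the
other sender offers `r`. -/
def continuation (k : ℝ) (σ : Strategy μ) (r : Experiment μ) (i : Fin 2) (x : ℝ) : ℝ :=
  open Classical in
  if x ∈ σ.visit i then stage2Payoff k x (σ.garble₂ i x r) else max x μ

/-- The receiver's expected payoff from garbling to `q` the distribution of the sender `i` visited
first, if the other sender offers `r`. -/
def stage1Payoff (k : ℝ) (σ : Strategy μ) (r : Experiment μ) (i : Fin 2) (q : Experiment μ) : ℝ :=
  ∫ x, (continuation k σ r i x - k * (x - μ) ^ 2) ∂q.law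

/-- The receiver's expected payoff from the order of visits `o`, if sender `i` offers `p i`. -/
def orderPayoff (k : ℝ) (p : Fin 2 → Experiment μ) (σ : Strategy μ) :
    Option (PMF (Fin 2)) → ℝ
  | none => μ
  | some w => ∑ i, (w i).toReal * stage1Payoff k σ (p (other i)) i (σ.garble₁ i (p i))

/-- Equilibrium. A distribution is observed only on visiting the sender who offers it; until then
the receiver counts on the equilibrium offer. Her behaviour is optimal at every point where she
moves, whatever has been offered and drawn before, and no sender gains by a unilateral
deviation. -/
structure IsEquilibrium (k : ℝ) (p : Fin 2 → Experiment μ) (σ : Strategy μ) : Prop where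
  garble₂_optimal : ∀ (i : Fin 2), ∀ x ∈ Icc (0 : ℝ) 1, ∀ r q : Experiment μ,
    IsGarbling q.law r.law → stage2Payoff k x q ≤ stage2Payoff k x (σ.garble₂ i x r)
  visit_optimal : ∀ (i : Fin 2), ∀ x ∈ Icc (0 : ℝ) 1,
    max (max x μ) (stage2Payoff k x (σ.garble₂ i x (p (other i)))) ≤
      continuation k σ (p (other i)) i x
  garble₁_optimal : ∀ (i : Fin 2) (r q : Experiment μ), IsGarbling q.law r.law →
    stage1Payoff k σ (p (other i)) i q ≤ stage1Payoff k σ (p (other i)) i (σ.garble₁ i r)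
  order_optimal : ∀ o, orderPayoff k p σ o ≤ orderPayoff k p σ σ.order
  sender_optimal : ∀ (i : Fin 2) (r : Experiment μ),
    senderPayoff (Function.update p i r) σ i ≤ senderPayoff p σ i

/-- The law of the outcome in which exactly one sender, drawn from `w`, is visited, the posterior
about him is `μ - ε` or `μ + ε` with equal probability, and he is selected in the latter case and
the other sender in the former. -/
def oneVisitOutcome (μ ε : ℝ) (w : PMF (Fin 2)) : Measure Outcome :=
  ∑ i, w i • ((2⁻¹ : ENNReal) • Measure.dirac (some i, beliefs i (μ - ε) μ, false, other i) +
    (2⁻¹ : ENNReal) • Measure.dirac (some i, beliefs i (μ + ε) μ, false, i))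

theorem mem_unit_of_mem {k μ : ℝ} (hk : 1 / 2 < k)
    (hμ : μ ∈ Icc (1 / (4 * k)) (1 - 1 / (4 * k))) : μ ∈ Icc (0 : ℝ) 1 := by
  have : 0 < 1 / (4 * k) := by positivity
  exact ⟨by linarith [hμ.1], by linarith [hμ.2]⟩

end Disclosure

end

namespace Disclosure

variable {μ k ε : ℝ}

/-! Put `ε = 1/(4k)`. At first belief `x` the second-stage integrand `max x y - k (y - μ)²` lies
below the line touching it at `y = x - ε` and `y = x + ε`. Evaluating that line at the mean shows
that no experiment yields more than `B x = x + k (x - μ - ε)²`, and that only the law on `x ± ε`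
yields as much (`stage2Payoff_le`, `law_eq_of_stage2Payoff_eq`). Stopping yields `max x μ`, which is
less than `B x` inside `(μ - ε, μ + ε)` and equal to it at both ends. The decisive coincidence is
that `B x - k (x - μ)²` is affine in `x`. Hence every first-stage garbling is worth at most `μ +
ε/4`, with equality exactly when `B` is attained at almost every first belief
(`stage1Payoff_eq_iff`).

Existence: learning `μ ± ε` from the first sender and stopping attains the bound, and so does
learning nothing from him and then `μ ± ε` from the other. The receiver can thus ignore at no loss a
sender who offers too little, and each sender is selected with probability 1/2 whatever he alone
does.

Equivalence: in an equilibrium with offers `p` the second route is open after any first offer, so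
`B` is attained almost surely. This determines the second-stage laws, and they stay optimal against
full information, of which everything is a garbling.

Subgame perfection also needs an optimal second-stage reply to every offer, measurable in `x`.
Two-point laws suffice (`exists_split_ge`). Compactness gives maximisers, and their monotonicity
gives measurability. -/

instance (q : Experiment μ) : IsProbabilityMeasure q.law := q.isProb

/-! ### Integrals against an experiment and supporting lines -/

theorem Experiment.ae_mem (q : Experiment μ) : ∀ᵐ x ∂q.law, x ∈ Icc (0 : ℝ) 1 := q.supported

theorem Experiment.integrable_of_continuous (q : Experiment μ) {f : ℝ → ℝ} (hf : Continuous f) :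
    Integrable f q.law := by
  have h : IntegrableOn f (Icc 0 1) q.law := hf.continuousOn.integrableOn_compact isCompact_Icc
  rwa [IntegrableOn, Measure.restrict_eq_self_of_ae_mem q.ae_mem] at h

theorem Experiment.integral_affine (q : Experiment μ) (c d : ℝ) :
    ∫ x, (c + d * x) ∂q.law = c + d * μ := by
  rw [integral_add (q.integrable_of_continuous (by fun_prop))
    (q.integrable_of_continuous (by fun_prop)), integral_const_mul, q.mean_eq]
  simp

theorem Experiment.prior_mem (q : Experiment μ) : μ ∈ Icc (0 : ℝ) 1 := by
  rw [← q.mean_eq]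
  constructor
  · exact integral_nonneg_of_ae (q.ae_mem.mono fun y hy => hy.1)
  · have := integral_mono_ae (q.integrable_of_continuous continuous_id)
      (integrable_const (1 : ℝ)) (q.ae_mem.mono fun y hy => hy.2)
    simpa using this

/-- A concave function on the line lies below some line through each point of its graph. -/
theorem exists_supergradient {u : ℝ → ℝ} (hu : ConcaveOn ℝ univ u) (a : ℝ) :
    ∃ c, ∀ y, u y ≤ u a + c * (y - a) := by
  have hv : ConvexOn ℝ univ (-u) := hu.neg
  have ha : ∀ z : ℝ, z ∈ interior (univ : Set ℝ) := by simp
  refine ⟨-derivWithin (-u) (Ioi a) a, fun y => ?_⟩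
  rcases lt_trichotomy y a with h | rfl | h
  · have h1 := hv.slope_le_leftDeriv_of_mem_interior (mem_univ y) (ha a) h
    have h2 := hv.leftDeriv_le_rightDeriv_of_mem_interior (ha a)
    have h3 := h1.trans h2
    rw [slope_def_field, div_le_iff₀ (by linarith)] at h3
    simp only [Pi.neg_apply] at h3
    linarith
  · simp
  · have h1 := hv.rightDeriv_le_slope_of_mem_interior (ha a) (mem_univ y) h
    rw [slope_def_field, le_div_iff₀ (by linarith)] at h1
    simp only [Pi.neg_apply] at h1
    linarith

theorem continuous_of_concave {u : ℝ → ℝ} (hu : ConcaveOn ℝ univ u) : Continuous u :=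
  continuousOn_univ.1 (hu.continuousOn isOpen_univ)

/-! ### Integrated distribution functions and two-point garblings -/

/-- The integral of the distribution function of `ν` up to `s`. -/
noncomputable def integratedCDF (ν : Measure ℝ) (s : ℝ) : ℝ := ∫ y, max (s - y) 0 ∂ν

theorem IsGarbling.integratedCDF_le {q r : Measure ℝ} (h : IsGarbling q r) (s : ℝ) :
    integratedCDF q s ≤ integratedCDF r s := by
  have h1 := h.2 (fun y => -max (s - y) 0) (fun a b hab => by
      have : max (s - b) 0 ≤ max (s - a) 0 := max_le_max (by linarith) le_rfl
      simpa using this) (by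
      have : ConvexOn ℝ univ (fun y : ℝ => max (s - y) 0) :=
        ((convexOn_const s convex_univ).sub (concaveOn_id convex_univ)).sup
          (convexOn_const 0 convex_univ)
      exact this.neg)
  rw [integral_neg, integral_neg] at h1
  exact neg_le_neg_iff.1 h1

theorem Experiment.le_integratedCDF (q : Experiment μ) (s : ℝ) :
    max (s - μ) 0 ≤ integratedCDF q.law s := by
  refine max_le ?_ (integral_nonneg fun y => le_max_right _ _)
  have := q.integral_affine s (-1)
  calc s - μ = ∫ y, (s + -1 * y) ∂q.law := by rw [this]; ring
    _ ≤ _ := integral_mono (q.integrable_of_continuous (by fun_prop))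
      (q.integrable_of_continuous (by fun_prop)) fun y => by
        simp only [neg_mul, one_mul, ← sub_eq_add_neg]; exact le_max_left _ _

theorem Experiment.integratedCDF_zero (q : Experiment μ) : integratedCDF q.law 0 = 0 := by
  rw [integratedCDF, ← integral_zero ℝ ℝ (μ := q.law)]
  refine integral_congr_ae ?_
  filter_upwards [q.ae_mem] with y hy
  simpa using hy.1

theorem Experiment.integratedCDF_one (q : Experiment μ) : integratedCDF q.law 1 = 1 - μ := by
  rw [integratedCDF, show 1 - μ = 1 + -1 * μ by ring, ← q.integral_affine 1 (-1)]
  refine integral_congr_ae ?_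
  filter_upwards [q.ae_mem] with y hy
  rw [max_eq_left (by linarith [hy.2])]; ring

/-- The law with mean `μ` carried by two points at distance `z`, the lower one having
probability `m`. -/
noncomputable def splitLaw (μ m z : ℝ) : Measure ℝ :=
  ENNReal.ofReal m • Measure.dirac (μ - (1 - m) * z) +
    ENNReal.ofReal (1 - m) • Measure.dirac (μ + m * z)

theorem integral_splitLaw {m : ℝ} (hm : m ∈ Icc (0 : ℝ) 1) (z : ℝ) (f : ℝ → ℝ) :
    ∫ x, f x ∂splitLaw μ m z = m * f (μ - (1 - m) * z) + (1 - m) * f (μ + m * z) := by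
  have i : ∀ c d : ℝ, Integrable f (ENNReal.ofReal c • Measure.dirac d) :=
    fun c d => (integrable_dirac (by simp)).smul_measure ENNReal.ofReal_ne_top
  rw [splitLaw, integral_add_measure (i _ _) (i _ _), integral_smul_measure,
    integral_smul_measure, integral_dirac, integral_dirac, ENNReal.toReal_ofReal hm.1,
    ENNReal.toReal_ofReal (by linarith [hm.2]), smul_eq_mul, smul_eq_mul]

/-- `splitLaw μ m z` is less spread out than `r`: its `integratedCDF` is the maximum of
`0`, `s - μ` and the line below. -/
def IsFeasibleSplit (μ : ℝ) (r : Measure ℝ) (m z : ℝ) : Prop :=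
  m ∈ Icc (0 : ℝ) 1 ∧ 0 ≤ z ∧ ∀ s, m * (s - μ) + m * (1 - m) * z ≤ integratedCDF r s

/-- A concave `u` lies below its supporting lines at the two atoms. The minimum of these lines is a
line minus `(α - β) * max (s - y) 0`, with `s` their crossing point, so feasibility at this single
`s` controls its integral under `r`. -/
theorem IsFeasibleSplit.isGarbling {r : Experiment μ} {m z : ℝ}
    (h : IsFeasibleSplit μ r.law m z) : IsGarbling (splitLaw μ m z) r.law := by
  obtain ⟨hm, hz, hs⟩ := h
  refine ⟨by rw [integral_splitLaw hm, r.mean_eq]; ring, fun u _ hu => ?_⟩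
  rw [integral_splitLaw hm]
  set a := μ - (1 - m) * z with ha
  set b := μ + m * z with hb
  obtain ⟨α, hα⟩ := exists_supergradient hu a
  obtain ⟨β, hβ, hαβ⟩ : ∃ β, (∀ y, u y ≤ u b + β * (y - b)) ∧ β ≤ α := by
    rcases hz.eq_or_lt with rfl | hz
    · have : a = b := by simp [ha, hb]
      exact ⟨α, this ▸ hα, le_rfl⟩
    · obtain ⟨β, hβ⟩ := exists_supergradient hu b
      refine ⟨β, hβ, ?_⟩
      have hab : b - a = z := by rw [ha, hb]; ring
      have h1 := hα b
      have h2 := hβ a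
      have : 0 ≤ (α - β) * z := by rw [← hab]; linarith
      nlinarith
  have hmean : m * a + (1 - m) * b = μ := by rw [ha, hb]; ring
  have hicont := r.integrable_of_continuous (continuous_of_concave hu)
  rcases hαβ.eq_or_lt with rfl | hlt
  · have h1 : ∫ y, u y ∂r.law ≤ ∫ y, (u b - β * b + β * y) ∂r.law :=
      integral_mono hicont (r.integrable_of_continuous (by fun_prop)) fun y => by
        have := hβ y; simp only; linarith
    rw [r.integral_affine] at h1
    have h2 : ∫ y, u y ∂r.law ≤ ∫ y, (u a - β * a + β * y) ∂r.law :=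
      integral_mono hicont (r.integrable_of_continuous (by fun_prop)) fun y => by
        have := hα y; simp only; linarith
    rw [r.integral_affine] at h2
    have h3 := mul_le_mul_of_nonneg_left h1 (sub_nonneg.2 hm.2)
    have h4 := mul_le_mul_of_nonneg_left h2 hm.1
    have h5 : β * (m * a + (1 - m) * b) = β * μ := by rw [hmean]
    linarith
  · obtain ⟨s, hs'⟩ : ∃ s, u a + α * (s - a) = u b + β * (s - b) := by
      have : α - β ≠ 0 := by linarith
      refine ⟨(u b - β * b - u a + α * a) / (α - β), ?_⟩
      field_simp
      ring
    have h1 : ∫ y, u y ∂r.law ≤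
        ∫ y, ((u b - β * b + β * y) - (α - β) * max (s - y) 0) ∂r.law :=
      integral_mono hicont (r.integrable_of_continuous (by fun_prop)) fun y => by
        simp only
        rcases le_total (s - y) 0 with h | h
        · rw [max_eq_right h]; linarith [hβ y]
        · rw [max_eq_left h]; linarith [hα y]
    rw [integral_sub (r.integrable_of_continuous (by fun_prop))
      (r.integrable_of_continuous (by fun_prop)), r.integral_affine, integral_const_mul] at h1
    have h2 := mul_le_mul_of_nonneg_left (hs s) (sub_nonneg.2 hlt.le)
    rw [integratedCDF] at h2
    refine h1.trans (le_trans (sub_le_sub_left h2 _) (le_of_eq ?_))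
    have h3 : u a = u b + β * (s - b) - α * (s - a) := by linarith
    rw [h3, ha, hb]; ring

theorem isProbabilityMeasure_splitLaw {m : ℝ} (hm : m ∈ Icc (0 : ℝ) 1) (z : ℝ) :
    IsProbabilityMeasure (splitLaw μ m z) := by
  refine ⟨?_⟩
  simp only [splitLaw, Measure.add_apply, Measure.smul_apply, measure_univ, smul_eq_mul, mul_one]
  rw [← ENNReal.ofReal_add hm.1 (by linarith [hm.2])]
  simp

/-- The experiment with law `splitLaw μ m z`. -/
noncomputable def IsFeasibleSplit.experiment {r : Experiment μ} {m z : ℝ}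
    (h : IsFeasibleSplit μ r.law m z) : Experiment μ where
  law := splitLaw μ m z
  isProb := isProbabilityMeasure_splitLaw h.1 z
  supported := by
    obtain ⟨hm, hz, hs⟩ := h
    have hμ := r.prior_mem
    -- Feasibility at `0` and at `1` keeps the lower atom above `0` and the upper one below `1`,
    -- unless the atom has no mass.
    have h0 := hs 0
    have h1 := hs 1
    rw [r.integratedCDF_zero] at h0
    rw [r.integratedCDF_one] at h1
    have c : MeasurableSet (Icc (0 : ℝ) 1)ᶜ := measurableSet_Icc.compl
    simp only [splitLaw, Measure.add_apply, Measure.smul_apply, Measure.dirac_apply' _ c,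
      smul_eq_mul, add_eq_zero, mul_eq_zero, ENNReal.ofReal_eq_zero]
    constructor
    · rcases hm.1.eq_or_lt with e | hpos
      · left; linarith
      · right
        rw [indicator_of_notMem]
        simp only [mem_compl_iff, not_not]
        constructor
        · have : m * (0 - μ + (1 - m) * z) ≤ m * 0 := by linarith
          linarith [le_of_mul_le_mul_left this hpos]
        · nlinarith [hμ.2, hm.2]
    · rcases hm.2.eq_or_lt with e | hlt
      · left; linarith
      · right
        rw [indicator_of_notMem]
        simp only [mem_compl_iff, not_not]
        constructor
        · nlinarith [hμ.1, hm.1]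
        · have : (1 - m) * (μ + m * z) ≤ (1 - m) * 1 := by linarith
          exact le_of_mul_le_mul_left this (by linarith)
  mean_eq := by rw [integral_splitLaw h.1]; ring

/-! ### Optimal second-stage garblings and their measurability -/

/-- The part of the payoff of a split that does not depend on the first belief. -/
noncomputable def splitGain (k m z : ℝ) : ℝ := m * (1 - m) * (z - k * z ^ 2)

/-- The payoff of a split at first belief `x`, with its lower point below and its upper point
above `x`. -/
noncomputable def splitPayoff (μ k x m z : ℝ) : ℝ := μ + m * (x - μ) + splitGain k m z

/-- Only an inequality, as both atoms may lie on the same side of `x`. It suffices because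
`splitPayoff` is the intermediate term that bounds every competitor. -/
theorem splitPayoff_le_stage2Payoff {q : Experiment μ} {m z : ℝ} (hm : m ∈ Icc (0 : ℝ) 1)
    (h : q.law = splitLaw μ m z) (x : ℝ) : splitPayoff μ k x m z ≤ stage2Payoff k x q := by
  rw [stage2Payoff, h, integral_splitLaw hm, splitPayoff, splitGain]
  have h1 := mul_le_mul_of_nonneg_left (le_max_left x (μ - (1 - m) * z)) hm.1
  have h2 := mul_le_mul_of_nonneg_left (le_max_right x (μ + m * z)) (sub_nonneg.2 hm.2)
  linarith

theorem integrable_stage2 (q : Experiment μ) (k x : ℝ) :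
    Integrable (fun y => max x y - k * (y - μ) ^ 2) q.law :=
  q.integrable_of_continuous (by fun_prop)

/-- Pooling all beliefs below `x`, and all other beliefs, does not hurt at first belief `x`. -/
theorem exists_split_ge (hk : 4 * k * ε = 1) (hε : 0 < ε) {r q : Experiment μ}
    (hq : IsGarbling q.law r.law) (x : ℝ) :
    ∃ m z, IsFeasibleSplit μ r.law m z ∧ z ≤ 2 * ε ∧
      stage2Payoff k x q ≤ splitPayoff μ k x m z := by
  have hk0 : 0 < k := by
    by_contra h
    nlinarith
  set φ : ℝ → ℝ := (Iio x).indicator 1 with hφ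
  have φ1 : ∀ y, y < x → φ y = 1 := fun y h => by simp [hφ, h]
  have φ0 : ∀ y, x ≤ y → φ y = 0 := fun y h => by simp [hφ, h]
  have φint : ∀ c d : ℝ, Integrable (fun y => φ y * (c + d * y)) q.law := fun c d => by
    have := (q.integrable_of_continuous (f := fun y => c + d * y) (by fun_prop)).indicator
      (measurableSet_Iio (a := x))
    refine this.congr (Filter.Eventually.of_forall fun y => ?_)
    by_cases h : y < x <;> simp [hφ, h]
  -- `m` is the mass below `x`. Pooling on either side of `x` gives conditional means at distance
  -- `z`, where `h = m * (1 - m) * z`.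
  set m := ∫ y, φ y ∂q.law with hm
  set h := ∫ y, φ y * (μ - y) ∂q.law with hh
  have i1 : Integrable φ q.law := by simpa using φint 1 0
  have i2 : Integrable (fun y => φ y * (μ - y)) q.law := by
    simpa [sub_eq_add_neg] using φint μ (-1)
  have hline : ∀ s, ∫ y, φ y * (s - y) ∂q.law = m * (s - μ) + h := fun s => by
    rw [hm, hh, ← integral_mul_const, ← integral_add (i1.mul_const _) i2]
    congr 1; ext y; ring
  have hs : ∀ s, m * (s - μ) + h ≤ integratedCDF r.law s := fun s => by
    refine le_trans ?_ (hq.integratedCDF_le s)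
    rw [← hline, integratedCDF]
    refine integral_mono (by simpa [sub_eq_add_neg] using φint s (-1))
      (q.integrable_of_continuous (by fun_prop)) fun y => ?_
    rcases lt_or_ge y x with hy | hy
    · simp [φ1 y hy]
    · simp [φ0 y hy]
  have m0 : 0 ≤ m := integral_nonneg fun y => by
    rcases lt_or_ge y x with hy | hy
    · simp [φ1 y hy]
    · simp [φ0 y hy]
  have m1 : m ≤ 1 := by
    have := integral_mono i1 (integrable_const (1 : ℝ)) fun y => by
      rcases lt_or_ge y x with hy | hy
      · simp [φ1 y hy]
      · simp [φ0 y hy]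
    simpa using this
  have h0 : 0 ≤ h := by
    rcases le_total x μ with hx | hx
    · refine integral_nonneg fun y => ?_
      rcases lt_or_ge y x with hy | hy
      · simp only [φ1 y hy, Pi.zero_apply]; linarith
      · simp [φ0 y hy]
    · have h1 := q.integral_affine μ (-1)
      have h2 : ∫ y, (μ + -1 * y) ∂q.law ≤ h :=
        integral_mono (q.integrable_of_continuous (by fun_prop)) i2 fun y => by
          rcases lt_or_ge y x with hy | hy
          · simp only [φ1 y hy]; linarith
          · simp only [φ0 y hy]; linarith
      linarith
  -- For `m = 0` or `m = 1` the equation for `z` is solvable only if `h = 0`; the values of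
  -- `integratedCDF` at `0` and `1` force this.
  have hmh0 : m = 0 → h = 0 := fun e => by
    have h1 := hs 0
    rw [r.integratedCDF_zero, e] at h1
    linarith
  have hmh1 : m = 1 → h = 0 := fun e => by
    have h1 := hs 1
    rw [r.integratedCDF_one, e] at h1
    linarith
  have hmm : 0 ≤ m * (1 - m) := mul_nonneg m0 (by linarith)
  obtain ⟨z, hz0, hz⟩ : ∃ z, 0 ≤ z ∧ h = m * (1 - m) * z := by
    rcases hmm.eq_or_lt with e | hpos
    · refine ⟨0, le_rfl, ?_⟩
      rcases mul_eq_zero.1 e.symm with e | e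
      · simpa using hmh0 e
      · simpa using hmh1 (by linarith)
    · exact ⟨h / (m * (1 - m)), div_nonneg h0 hpos.le, by rw [mul_comm, div_mul_cancel₀ _ hpos.ne']⟩
  have i3 : Integrable (fun y => φ y * (μ - y) * (2 * z) - φ y * (z ^ 2 * (1 - 2 * m))) q.law :=
    (i2.mul_const _).sub (i1.mul_const _)
  -- Pooling lowers the variance. Pointwise this is the nonnegativity of the squared distance from
  -- `y` to the mean of its own group.
  have hvar : m * (1 - m) * z ^ 2 ≤ ∫ y, (y - μ) ^ 2 ∂q.law := by
    have h1 : ∫ y, (φ y * (μ - y) * (2 * z) - φ y * (z ^ 2 * (1 - 2 * m)) +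
        ((-(2 * z * m * μ) - z ^ 2 * m ^ 2) + 2 * z * m * y)) ∂q.law ≤
        ∫ y, (y - μ) ^ 2 ∂q.law := by
      refine integral_mono (i3.add
        (q.integrable_of_continuous (by fun_prop)))
        (q.integrable_of_continuous (by fun_prop)) fun y => ?_
      rcases lt_or_ge y x with hy | hy
      · simp only [φ1 y hy]; nlinarith [sq_nonneg (y - μ + z * (1 - m))]
      · simp only [φ0 y hy]; nlinarith [sq_nonneg (y - μ - z * m)]
    rw [integral_add i3
        (q.integrable_of_continuous (by fun_prop)), q.integral_affine,
      integral_sub (i2.mul_const _) (i1.mul_const _), integral_mul_const, integral_mul_const,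
      ← hm, ← hh, hz] at h1
    linarith
  have hpay : stage2Payoff k x q = μ + m * (x - μ) + h - k * ∫ y, (y - μ) ^ 2 ∂q.law := by
    have e : ∀ y, max x y - k * (y - μ) ^ 2 =
        ((0 + 1 * y) + φ y * (x - y)) - k * (y - μ) ^ 2 := fun y => by
      rcases lt_or_ge y x with hy | hy
      · rw [φ1 y hy, max_eq_left hy.le]; ring
      · rw [φ0 y hy, max_eq_right hy]; ring
    have i4 : Integrable (fun y => φ y * (x - y)) q.law := by
      simpa [sub_eq_add_neg] using φint x (-1)
    have i5 : Integrable (fun y : ℝ => 0 + 1 * y) q.law :=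
      q.integrable_of_continuous (by fun_prop)
    have i6 : Integrable (fun y : ℝ => 0 + 1 * y + φ y * (x - y)) q.law := i5.add i4
    rw [stage2Payoff]
    simp_rw [e]
    rw [integral_sub i6 (q.integrable_of_continuous (by fun_prop)), integral_add i5 i4,
      q.integral_affine, hline, integral_const_mul]
    ring
  have hle : stage2Payoff k x q ≤ splitPayoff μ k x m z := by
    rw [hpay, splitPayoff, splitGain]
    have := mul_le_mul_of_nonneg_left hvar hk0.le
    linarith
  -- `z - k * z ^ 2` peaks at `z = 2 * ε`, and reducing `z` preserves feasibility, so larger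
  -- distances can be cut to `2 * ε`.
  rcases le_total z (2 * ε) with hz2 | hz2
  · exact ⟨m, z, ⟨⟨m0, m1⟩, hz0, fun s => by rw [← hz]; exact hs s⟩, hz2, hle⟩
  · refine ⟨m, 2 * ε, ⟨⟨m0, m1⟩, by linarith, fun s => ?_⟩, le_rfl, hle.trans ?_⟩
    · refine le_trans ?_ (hs s)
      rw [hz]
      gcongr
    · rw [splitPayoff, splitPayoff, splitGain, splitGain]
      have : z - k * z ^ 2 ≤ 2 * ε - k * (2 * ε) ^ 2 := by
        nlinarith [mul_nonneg hk0.le (sq_nonneg (z - 2 * ε))]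
      gcongr

theorem isCompact_feasibleSplits (r : Experiment μ) (d : ℝ) :
    IsCompact {w : ℝ × ℝ | IsFeasibleSplit μ r.law w.1 w.2 ∧ w.2 ≤ d} := by
  refine (isCompact_Icc.prod isCompact_Icc (s := Icc (0 : ℝ) 1) (t := Icc 0 d)).of_isClosed_subset
    ?_ fun w hw => ⟨hw.1.1, hw.1.2.1, hw.2⟩
  simp only [IsFeasibleSplit, ofPred_and, ofPred_forall]
  refine IsClosed.inter (IsClosed.inter ?_ (IsClosed.inter ?_ ?_)) ?_
  · exact isClosed_Icc.preimage continuous_fst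
  · exact isClosed_le continuous_const continuous_snd
  · exact isClosed_iInter fun s => isClosed_le (by fun_prop) continuous_const
  · exact isClosed_le continuous_snd continuous_const

theorem exists_optimal_split (hε : 0 < ε) (r : Experiment μ) (x : ℝ) :
    ∃ m z, IsFeasibleSplit μ r.law m z ∧ z ≤ 2 * ε ∧ ∀ m' z', IsFeasibleSplit μ r.law m' z' →
      z' ≤ 2 * ε → splitPayoff μ k x m' z' ≤ splitPayoff μ k x m z := by
  have hne : {w : ℝ × ℝ | IsFeasibleSplit μ r.law w.1 w.2 ∧ w.2 ≤ 2 * ε}.Nonempty :=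
    ⟨(0, 0), ⟨by simp, le_rfl, fun s => by
      simpa using (le_max_right _ _).trans (r.le_integratedCDF s)⟩, by simp [hε.le]⟩
  obtain ⟨w, hw, hmax⟩ := (isCompact_feasibleSplits r (2 * ε)).exists_isMaxOn hne
    (f := fun w => splitPayoff μ k x w.1 w.2) (by unfold splitPayoff splitGain; fun_prop)
  exact ⟨w.1, w.2, hw.1, hw.2, fun m' z' h h' => hmax (a := (m', z')) ⟨h, h'⟩⟩

/-- The maximisers are monotone in the first belief, because only `m * (x - μ)` depends on it. -/
theorem exists_measurable_optimal_garbling (hk : 4 * k * ε = 1) (hε : 0 < ε) (r : Experiment μ) :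
    ∃ q : ℝ → Experiment μ, (∀ x, IsGarbling (q x).law r.law) ∧ (Measurable fun x => (q x).law) ∧
      ∀ x, ∀ q' : Experiment μ, IsGarbling q'.law r.law →
        stage2Payoff k x q' ≤ stage2Payoff k x (q x) := by
  have hk0 : 0 < k := by
    by_contra h
    nlinarith
  choose m z hf hz hmax using fun x => exists_optimal_split (k := k) hε r x
  refine ⟨fun x => (hf x).experiment, fun x => (hf x).isGarbling, ?_, fun x q' hq' => ?_⟩
  swap
  · obtain ⟨m', z', h1, h2, h3⟩ := exists_split_ge hk hε hq' x
    exact h3.trans ((hmax x m' z' h1 h2).trans (splitPayoff_le_stage2Payoff (hf x).1 rfl x))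
  -- Adding the optimality inequalities of the two maximisers, each at its own belief, cancels the
  -- gains and leaves `(m y - m x) * (y - x) ≥ 0`.
  have mmono : Monotone m := fun x y hxy => by
    rcases hxy.eq_or_lt with rfl | hlt
    · rfl
    have h1 := hmax x _ _ (hf y) (hz y)
    have h2 := hmax y _ _ (hf x) (hz x)
    simp only [splitPayoff] at h1 h2
    by_contra hcon
    push Not at hcon
    nlinarith [mul_pos (sub_pos.2 hcon) (sub_pos.2 hlt)]
  have vmono : Monotone fun x => splitPayoff μ k x (m x) (z x) := fun x y hxy => by
    refine le_trans ?_ (hmax y _ _ (hf x) (hz x))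
    simp only [splitPayoff]
    have := mul_le_mul_of_nonneg_left hxy (hf x).1.1
    linarith
  have mmeas := mmono.measurable
  -- The chosen `z` need not be measurable. But `m` and the optimal value are monotone, and they
  -- determine `g x = z x - k * z x ^ 2` unless `m x` is `0` or `1`, where the law ignores `z`. The
  -- root that is at most `2 * ε` is `ζ x`.
  set g : ℝ → ℝ := fun x =>
    (splitPayoff μ k x (m x) (z x) - μ - m x * (x - μ)) / (m x * (1 - m x)) with hg
  have gmeas : Measurable g := by
    have := vmono.measurable
    exact ((this.sub_const μ).sub (mmeas.mul (measurable_id.sub_const μ))).div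
      (mmeas.mul (measurable_const.sub mmeas))
  set ζ : ℝ → ℝ := fun x => 2 * ε * (1 - √(1 - 4 * k * g x)) with hζ
  have ζmeas : Measurable ζ := by fun_prop
  have hzζ : ∀ x, m x * (1 - m x) ≠ 0 → ζ x = z x := fun x hx => by
    have : g x = z x - k * z x ^ 2 := by
      simp only [hg, splitPayoff, splitGain]
      rw [div_eq_iff hx]
      ring
    have e : 1 - 4 * k * g x = (1 - 2 * k * z x) ^ 2 := by rw [this]; ring
    have h1 : 0 ≤ 1 - 2 * k * z x := by
      have := mul_le_mul_of_nonneg_left (hz x) (mul_pos two_pos hk0).le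
      linarith
    simp only [hζ]
    rw [e, Real.sqrt_sq h1]
    linear_combination z x * hk
  have hlaw : ∀ x, splitLaw μ (m x) (z x) = splitLaw μ (m x) (ζ x) := fun x => by
    by_cases hx : m x * (1 - m x) = 0
    · rcases mul_eq_zero.1 hx with e | e
      · simp [splitLaw, e]
      · have e' : m x = 1 := by linarith
        simp [splitLaw, e']
    · rw [hzζ x hx]
  change Measurable fun x => splitLaw μ (m x) (z x)
  simp_rw [hlaw]
  refine Measure.measurable_of_measurable_coe _ fun s hs => ?_
  simp only [splitLaw, Measure.add_apply, Measure.smul_apply, smul_eq_mul]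
  have hd := Measure.measurable_coe hs (α := ℝ)
  have a1 : Measurable fun x => μ - (1 - m x) * ζ x := by fun_prop
  have a2 : Measurable fun x => μ + m x * ζ x := by fun_prop
  exact (mmeas.ennreal_ofReal.mul (hd.comp (Measure.measurable_dirac.comp a1))).add
    ((measurable_const.sub mmeas).ennreal_ofReal.mul (hd.comp (Measure.measurable_dirac.comp a2)))

/-! ### No information and full information as extreme garblings -/

theorem pos_of_four_mul_eq (hk : 4 * k * ε = 1) (hε : 0 < ε) : 0 < k := by
  by_contra h
  nlinarith

/-- The experiment that reveals nothing. -/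
noncomputable def Experiment.noInfo (hμ : μ ∈ Icc (0 : ℝ) 1) : Experiment μ where
  law := Measure.dirac μ
  isProb := inferInstance
  supported := by
    rw [Measure.dirac_apply' _ measurableSet_Icc.compl, indicator_of_notMem]
    simpa using hμ
  mean_eq := by simp

theorem Experiment.noInfo_isGarbling (hμ : μ ∈ Icc (0 : ℝ) 1) (r : Experiment μ) :
    IsGarbling (noInfo hμ).law r.law := by
  refine ⟨by rw [mean_eq, mean_eq], fun u _ hu => ?_⟩
  obtain ⟨c, hc⟩ := exists_supergradient hu μ
  calc ∫ x, u x ∂r.law ≤ ∫ x, (u μ - c * μ + c * x) ∂r.law :=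
        integral_mono (r.integrable_of_continuous (continuous_of_concave hu))
          (r.integrable_of_continuous (by fun_prop)) fun y => by
            have := hc y; simp only; linarith
    _ = u μ := by rw [r.integral_affine]; ring
    _ = ∫ x, u x ∂(noInfo hμ).law := by simp [noInfo]

theorem stage2Payoff_noInfo (hμ : μ ∈ Icc (0 : ℝ) 1) (x : ℝ) :
    stage2Payoff k x (.noInfo hμ) = max x μ := by
  simp [stage2Payoff, Experiment.noInfo]

theorem stage1Payoff_noInfo (hμ : μ ∈ Icc (0 : ℝ) 1) (σ : Strategy μ) (r : Experiment μ)
    (i : Fin 2) : stage1Payoff k σ r i (.noInfo hμ) = continuation k σ r i μ := by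
  simp [stage1Payoff, Experiment.noInfo]

theorem twoPointLaw_eq_splitLaw {a b : ℝ} (hab : a < b) :
    twoPointLaw μ a b = splitLaw μ ((b - μ) / (b - a)) (b - a) := by
  have h : b - a ≠ 0 := by linarith
  have e1 : 1 - (b - μ) / (b - a) = (μ - a) / (b - a) := by field_simp; ring
  have e2 : (μ - a) / (b - a) * (b - a) = μ - a := div_mul_cancel₀ _ h
  have e3 : (b - μ) / (b - a) * (b - a) = b - μ := div_mul_cancel₀ _ h
  rw [twoPointLaw, splitLaw, e1, e2, e3]
  simp

theorem Experiment.isGarbling_full (hμ : μ ∈ Icc (0 : ℝ) 1) (q : Experiment μ) :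
    IsGarbling q.law (full μ hμ).law := by
  refine ⟨by rw [mean_eq, mean_eq], fun u _ hu => ?_⟩
  change ∫ x, u x ∂twoPointLaw μ 0 1 ≤ _
  rw [twoPointLaw_eq_splitLaw one_pos, integral_splitLaw (by
    constructor <;> simp [hμ.1, hμ.2])]
  have e : ∫ x, (u 0 + (u 1 - u 0) * x) ∂q.law ≤ ∫ x, u x ∂q.law := by
    refine integral_mono_ae (q.integrable_of_continuous (by fun_prop))
      (q.integrable_of_continuous (continuous_of_concave hu)) ?_
    filter_upwards [q.ae_mem] with x hx
    have := hu.2 (mem_univ 0) (mem_univ 1) (sub_nonneg.2 hx.2) hx.1 (by ring)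
    simp only [smul_eq_mul, mul_zero, mul_one, zero_add] at this
    linarith
  rw [q.integral_affine] at e
  simp only [sub_zero, div_one, sub_sub_cancel, mul_one, sub_self, add_sub_cancel] at e ⊢
  linarith

/-! ### The tangent bound on the second-stage payoff -/

/-- The line tangent to both branches of the second-stage payoff at first belief `x`. -/
theorem tangent_sub_eq (hk : 4 * k * ε = 1) (x y : ℝ) :
    (x - k * (x - ε - μ) ^ 2 - 2 * k * (x - ε - μ) * (y - (x - ε))) -
      (max x y - k * (y - μ) ^ 2) =
      if y < x then k * (y - (x - ε)) ^ 2 else k * (y - (x + ε)) ^ 2 := by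
  split_ifs with h
  · rw [max_eq_left h.le]; ring
  · rw [max_eq_right (not_lt.1 h)]
    linear_combination (y - x) * hk

/-- The tangent integrates to its value at the mean, so the shortfall from the bound is `k` times
the mean squared distance to the contact point on the same side of `x`. -/
theorem integral_tangent_sub (hk : 4 * k * ε = 1) (q : Experiment μ) (x : ℝ) :
    ∫ y, (if y < x then k * (y - (x - ε)) ^ 2 else k * (y - (x + ε)) ^ 2) ∂q.law =
      x + k * (x - μ - ε) ^ 2 - stage2Payoff k x q := by
  simp_rw [← tangent_sub_eq hk (μ := μ)]
  rw [integral_sub (q.integrable_of_continuous (by fun_prop)) (integrable_stage2 q k x),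
    stage2Payoff]
  congr 1
  have := q.integral_affine (x - k * (x - ε - μ) ^ 2 + 2 * k * (x - ε - μ) * (x - ε))
    (-(2 * k * (x - ε - μ)))
  refine Eq.trans ?_ (this.trans ?_)
  · congr 1; ext y; ring
  · ring

theorem tangent_sub_nonneg (hk : 0 < k) (x y : ℝ) :
    0 ≤ if y < x then k * (y - (x - ε)) ^ 2 else k * (y - (x + ε)) ^ 2 := by
  split_ifs <;> positivity

theorem stage2Payoff_le (hk : 4 * k * ε = 1) (hε : 0 < ε) (q : Experiment μ) (x : ℝ) :
    stage2Payoff k x q ≤ x + k * (x - μ - ε) ^ 2 := by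
  have h := integral_tangent_sub hk q x
  have h0 : 0 ≤ ∫ y, (if y < x then k * (y - (x - ε)) ^ 2 else k * (y - (x + ε)) ^ 2) ∂q.law :=
    integral_nonneg fun y => tangent_sub_nonneg (pos_of_four_mul_eq hk hε) x y
  linarith

/-- An experiment carried by two points is determined by them. -/
theorem Experiment.law_eq_twoPointLaw (q : Experiment μ) {a b : ℝ} (hab : a < b)
    (h : ∀ᵐ y ∂q.law, y = a ∨ y = b) : q.law = twoPointLaw μ a b := by
  have h1 : q.law = q.law {a} • Measure.dirac a + q.law {b} • Measure.dirac b := by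
    have h2 : q.law.restrict ({a} ∪ {b}) = q.law :=
      Measure.restrict_eq_self_of_ae_mem (h.mono fun y hy => hy)
    rw [← Measure.restrict_singleton, ← Measure.restrict_singleton, ← Measure.restrict_union
      (by simpa using hab.ne) (measurableSet_singleton b), h2]
  have hsum : q.law.real {a} + q.law.real {b} = 1 := by
    have h3 := congrArg (fun ν : Measure ℝ => ν univ) h1
    simp only [measure_univ, Measure.add_apply, Measure.smul_apply, smul_eq_mul, mul_one] at h3
    rw [measureReal_def, measureReal_def, ← ENNReal.toReal_add (measure_ne_top _ _)
      (measure_ne_top _ _), ← h3]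
    simp
  have i : ∀ c : ℝ, Integrable (fun x : ℝ => x) (q.law {c} • Measure.dirac c) :=
    fun c => (integrable_dirac (by simp)).smul_measure (measure_ne_top _ _)
  have hmean : q.law.real {a} * a + q.law.real {b} * b = μ := by
    have h4 := q.mean_eq
    rw [h1, integral_add_measure (i _) (i _), integral_smul_measure, integral_smul_measure,
      integral_dirac, integral_dirac, smul_eq_mul, smul_eq_mul] at h4
    exact h4
  have hne : b - a ≠ 0 := by linarith
  have ea : q.law.real {a} = (b - μ) / (b - a) := by
    rw [eq_div_iff hne]; linear_combination b * hsum - hmean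
  have eb : q.law.real {b} = (μ - a) / (b - a) := by
    rw [eq_div_iff hne]; linear_combination hmean - a * hsum
  rw [twoPointLaw, ← ea, ← eb, ofReal_measureReal, ofReal_measureReal, ← h1]

/-- A zero shortfall puts almost every posterior at a contact point, and the mean then fixes the
weights. -/
theorem law_eq_of_stage2Payoff_eq (hk : 4 * k * ε = 1) (hε : 0 < ε) {q : Experiment μ} {x : ℝ}
    (h : stage2Payoff k x q = x + k * (x - μ - ε) ^ 2) :
    q.law = twoPointLaw μ (x - ε) (x + ε) := by
  have k0 := pos_of_four_mul_eq hk hε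
  have h1 := integral_tangent_sub hk q x
  rw [h, sub_self, integral_eq_zero_iff_of_nonneg (fun y => tangent_sub_nonneg k0 x y)] at h1
  · refine q.law_eq_twoPointLaw (by linarith) (h1.mono fun y hy => ?_)
    simp only [Pi.zero_apply] at hy
    split_ifs at hy
    · left
      have := pow_eq_zero_iff (two_ne_zero) |>.1 ((mul_eq_zero.1 hy).resolve_left k0.ne')
      linarith
    · right
      have := pow_eq_zero_iff (two_ne_zero) |>.1 ((mul_eq_zero.1 hy).resolve_left k0.ne')
      linarith
  · simp_rw [← tangent_sub_eq hk (μ := μ)]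
    exact q.integrable_of_continuous (by fun_prop)

/-- Beliefs far from the prior cannot be improved upon. -/
theorem stage2Payoff_le_max (hk : 4 * k * ε = 1) (hε : 0 < ε) (q : Experiment μ) {x : ℝ}
    (hx : x ∉ Ioo (μ - ε) (μ + ε)) : stage2Payoff k x q ≤ max x μ := by
  have k0 := pos_of_four_mul_eq hk hε
  have hpt : ∀ s, s - k * s ^ 2 ≤ ε := fun s => by
    have : ε - (s - k * s ^ 2) = k * (s - 2 * ε) ^ 2 := by linear_combination (s - ε) * hk
    nlinarith [mul_nonneg k0.le (sq_nonneg (s - 2 * ε))]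
  have main : ∀ c d, (∀ y, max x y - k * (y - μ) ^ 2 ≤ c + d * y) →
      stage2Payoff k x q ≤ c + d * μ := fun c d h => by
    rw [← q.integral_affine]
    exact integral_mono (integrable_stage2 q k x) (q.integrable_of_continuous (by fun_prop)) h
  -- The affine majorant is `y` on the left and the constant `x` on the right; at the mean these
  -- equal `μ` and `x`.
  rcases le_or_gt x (μ - ε) with h | h
  · refine (main 0 1 fun y => ?_).trans (by simp)
    have h1 := hpt (μ - y)
    have h2 : k * (μ - y) ^ 2 = k * (y - μ) ^ 2 := by ring
    have h3 : 0 ≤ k * (y - μ) ^ 2 := by positivity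
    rcases max_choice x y with e | e <;> rw [e] <;> linarith
  · have h' : μ + ε ≤ x := by
      by_contra hc
      exact hx ⟨h, not_le.1 hc⟩
    refine (main x 0 fun y => ?_).trans (by simp)
    have h1 := hpt (y - μ)
    have h3 : 0 ≤ k * (y - μ) ^ 2 := by positivity
    rcases max_choice x y with e | e <;> rw [e] <;> linarith

/-- The two expressions for the bound on the second-stage payoff. -/
theorem bound_eq (hk : 4 * k * ε = 1) (x : ℝ) :
    x + k * (x - μ - ε) ^ 2 = μ + k * (x - μ + ε) ^ 2 := by
  linear_combination -(x - μ) * hk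

theorem max_le_bound (hk : 4 * k * ε = 1) (hε : 0 < ε) (x : ℝ) :
    max x μ ≤ x + k * (x - μ - ε) ^ 2 := by
  have k0 := pos_of_four_mul_eq hk hε
  refine max_le ?_ ?_
  · have : 0 ≤ k * (x - μ - ε) ^ 2 := by positivity
    linarith
  · rw [bound_eq hk]
    have : 0 ≤ k * (x - μ + ε) ^ 2 := by positivity
    linarith

theorem max_lt_bound (hk : 4 * k * ε = 1) (hε : 0 < ε) {x : ℝ}
    (hx : x ∈ Ioo (μ - ε) (μ + ε)) : max x μ < x + k * (x - μ - ε) ^ 2 := by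
  have k0 := pos_of_four_mul_eq hk hε
  refine max_lt ?_ ?_
  · have h : x - μ - ε ≠ 0 := by linarith [hx.2]
    have : 0 < k * (x - μ - ε) ^ 2 := by positivity
    linarith
  · rw [bound_eq hk]
    have h : x - μ + ε ≠ 0 := by linarith [hx.1]
    have : 0 < k * (x - μ + ε) ^ 2 := by positivity
    linarith

/-! ### The bound on the first-stage payoff -/

theorem continuation_le (hk : 4 * k * ε = 1) (hε : 0 < ε) (σ : Strategy μ) (r : Experiment μ)
    (i : Fin 2) (x : ℝ) : continuation k σ r i x ≤ x + k * (x - μ - ε) ^ 2 := by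
  rw [continuation]
  split_ifs
  · exact stage2Payoff_le hk hε _ x
  · exact max_le_bound hk hε x

/-- Net of the attention cost, the bound is affine in the first belief. -/
theorem bound_sub_cost (hk : 4 * k * ε = 1) (x : ℝ) :
    x + k * (x - μ - ε) ^ 2 - k * (x - μ) ^ 2 = (μ / 2 + ε / 4) + 1 / 2 * x := by
  linear_combination (ε / 4 - (x - μ) / 2) * hk

theorem stage1Payoff_le (hk : 4 * k * ε = 1) (hε : 0 < ε) (σ : Strategy μ) (r q : Experiment μ)
    (i : Fin 2) : stage1Payoff k σ r i q ≤ μ + ε / 4 := by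
  have e := q.integral_affine (μ / 2 + ε / 4) (1 / 2)
  have iB : Integrable (fun x => (μ / 2 + ε / 4) + 1 / 2 * x) q.law :=
    q.integrable_of_continuous (by fun_prop)
  rw [stage1Payoff]
  by_cases hint : Integrable (fun x => continuation k σ r i x - k * (x - μ) ^ 2) q.law
  · have := integral_mono hint iB fun x => by
      simp only
      rw [← bound_sub_cost hk]
      exact sub_le_sub_right (continuation_le hk hε σ r i x) _
    linarith
  -- Without integrability the integral is `0` by convention, still below the bound since `μ ≥ 0`.
  · rw [integral_undef hint]
    linarith [q.prior_mem.1]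

/-- The gap below the affine bound is nonnegative, so it integrates to zero only if it vanishes
almost everywhere. -/
theorem stage1Payoff_eq_iff (hk : 4 * k * ε = 1) (hε : 0 < ε) (σ : Strategy μ)
    (r q : Experiment μ) (i : Fin 2) : stage1Payoff k σ r i q = μ + ε / 4 ↔
      ∀ᵐ x ∂q.law, continuation k σ r i x = x + k * (x - μ - ε) ^ 2 := by
  have e := q.integral_affine (μ / 2 + ε / 4) (1 / 2)
  have iB : Integrable (fun x => (μ / 2 + ε / 4) + 1 / 2 * x) q.law :=
    q.integrable_of_continuous (by fun_prop)
  rw [stage1Payoff]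
  constructor
  · intro h
    have hint : Integrable (fun x => continuation k σ r i x - k * (x - μ) ^ 2) q.law := by
      by_contra hint
      rw [integral_undef hint] at h
      linarith [q.prior_mem.1]
    have h0 : ∫ x, ((μ / 2 + ε / 4) + 1 / 2 * x -
        (continuation k σ r i x - k * (x - μ) ^ 2)) ∂q.law = 0 := by
      rw [integral_sub iB hint]; linarith
    have h1 := (integral_eq_zero_iff_of_nonneg (fun x => ?_) (iB.sub hint)).1 h0
    · filter_upwards [h1] with x hx
      simp only [Pi.zero_apply, Pi.sub_apply, ← bound_sub_cost hk] at hx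
      linarith
    · simp only [Pi.zero_apply, Pi.sub_apply, ← bound_sub_cost hk]
      linarith [continuation_le hk hε σ r i x]
  · intro h
    refine (integral_congr_ae ?_).trans (e.trans (by ring))
    filter_upwards [h] with x hx
    rw [hx, bound_sub_cost hk]

/-! ### Symmetric two-point laws, outcomes and orders of visits -/

/-- The law putting probability `1/2` on each of `μ - ε` and `μ + ε`. -/
theorem twoPointLaw_symm (hε : 0 < ε) :
    twoPointLaw μ (μ - ε) (μ + ε) = (2⁻¹ : ENNReal) • Measure.dirac (μ - ε) +
      (2⁻¹ : ENNReal) • Measure.dirac (μ + ε) := by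
  have e1 : (μ + ε - μ) / (μ + ε - (μ - ε)) = 2⁻¹ := by rw [div_eq_iff (by linarith)]; ring
  have e2 : (μ - (μ - ε)) / (μ + ε - (μ - ε)) = 2⁻¹ := by
    rw [div_eq_iff (by linarith)]; ring
  rw [twoPointLaw, e1, e2, ENNReal.ofReal_inv_of_pos two_pos, ENNReal.ofReal_ofNat]

theorem stage2Payoff_symm (hk : 4 * k * ε = 1) (hε : 0 < ε) {q : Experiment μ}
    (hq : q.law = twoPointLaw μ (μ - ε) (μ + ε)) :
    stage2Payoff k μ q = μ + k * (μ - μ - ε) ^ 2 := by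
  rw [stage2Payoff, hq, twoPointLaw_eq_splitLaw (by linarith)]
  have e1 : (μ + ε - μ) / (μ + ε - (μ - ε)) = 2⁻¹ := by rw [div_eq_iff (by linarith)]; ring
  rw [e1, integral_splitLaw (by constructor <;> norm_num)]
  have e2 : μ - (1 - 2⁻¹) * (μ + ε - (μ - ε)) = μ - ε := by ring
  have e3 : μ + 2⁻¹ * (μ + ε - (μ - ε)) = μ + ε := by ring
  rw [e2, e3, max_eq_left (by linarith), max_eq_right (by linarith)]
  linear_combination (-ε / 2) * hk

theorem other_ne (i : Fin 2) : other i ≠ i := by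
  fin_cases i <;> decide

theorem eq_or_eq_other (i j : Fin 2) : j = i ∨ j = other i := by
  fin_cases i <;> fin_cases j <;> decide

/-- No measurability of `f` is needed: against a point mass every function is almost everywhere
constant. -/
theorem bind_dirac_left {α β : Type*} [MeasurableSpace α] [MeasurableSingletonClass α]
    [MeasurableSpace β] (a : α) (f : α → Measure β) : (Measure.dirac a).bind f = f a := by
  ext s hs
  rw [Measure.bind_apply hs aemeasurable_dirac, lintegral_dirac]

theorem bind_twoPointLaw_symm {β : Type*} [MeasurableSpace β] (hε : 0 < ε)
    (f : ℝ → Measure β) : (twoPointLaw μ (μ - ε) (μ + ε)).bind f =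
      (2⁻¹ : ENNReal) • f (μ - ε) + (2⁻¹ : ENNReal) • f (μ + ε) := by
  ext s hs
  rw [twoPointLaw_symm hε, Measure.bind_apply hs ((aemeasurable_dirac.smul_measure _).add_measure
    (aemeasurable_dirac.smul_measure _)), lintegral_add_measure, lintegral_smul_measure,
    lintegral_smul_measure, lintegral_dirac, lintegral_dirac]
  rfl

theorem Strategy.select_of_lt (σ : Strategy μ) (i : Fin 2) {x y : ℝ} (h : y < x) (b : Bool) :
    σ.select i x y b = Measure.dirac (some i, beliefs i x y, b, i) := by
  simp [select, selectFirst, h]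

theorem Strategy.select_of_gt (σ : Strategy μ) (i : Fin 2) {x y : ℝ} (h : x < y) (b : Bool) :
    σ.select i x y b = Measure.dirac (some i, beliefs i x y, b, other i) := by
  simp [select, selectFirst, h, h.not_gt]

theorem measurableSet_selected (i : Fin 2) : MeasurableSet {o : Outcome | o.2.2.2 = i} :=
  measurableSet_eq_fun (by fun_prop) measurable_const

theorem sum_coe_pmf (w : PMF (Fin 2)) : ∑ i, w i = 1 := by
  rw [← w.tsum_coe, tsum_fintype]

theorem sum_toReal_pmf (w : PMF (Fin 2)) : ∑ i, (w i).toReal = 1 := by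
  rw [← ENNReal.toReal_sum fun i _ => w.apply_ne_top i, sum_coe_pmf, ENNReal.toReal_one]

theorem orderPayoff_le (hk : 4 * k * ε = 1) (hε : 0 < ε) (p : Fin 2 → Experiment μ)
    (σ : Strategy μ) (o : Option (PMF (Fin 2))) : orderPayoff k p σ o ≤ μ + ε / 4 := by
  cases o with
  | none => change μ ≤ _; linarith
  | some w =>
    calc ∑ i, (w i).toReal * stage1Payoff k σ (p (other i)) i (σ.garble₁ i (p i))
        ≤ ∑ i, (w i).toReal * (μ + ε / 4) := Finset.sum_le_sum fun i _ =>
          mul_le_mul_of_nonneg_left (stage1Payoff_le hk hε _ _ _ _) ENNReal.toReal_nonneg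
      _ = _ := by rw [← Finset.sum_mul, sum_toReal_pmf, one_mul]

theorem orderPayoff_some (p : Fin 2 → Experiment μ) (σ : Strategy μ) (w : PMF (Fin 2))
    (h : ∀ i, stage1Payoff k σ (p (other i)) i (σ.garble₁ i (p i)) = μ + ε / 4) :
    orderPayoff k p σ (some w) = μ + ε / 4 := by
  change ∑ i, (w i).toReal * stage1Payoff k σ (p (other i)) i (σ.garble₁ i (p i)) = _
  simp_rw [h]
  rw [← Finset.sum_mul, sum_toReal_pmf, one_mul]

/-- An optimal response at the prior to an offer of which the two-point law is a garbling. -/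
theorem stage2Payoff_eq_at_prior (hk : 4 * k * ε = 1) (hε : 0 < ε) {pair r q : Experiment μ}
    (hpair : pair.law = twoPointLaw μ (μ - ε) (μ + ε)) (hr : IsGarbling pair.law r.law)
    (hq : ∀ q' : Experiment μ, IsGarbling q'.law r.law →
      stage2Payoff k μ q' ≤ stage2Payoff k μ q) :
    stage2Payoff k μ q = μ + k * (μ - μ - ε) ^ 2 :=
  le_antisymm (stage2Payoff_le hk hε q μ) (stage2Payoff_symm hk hε hpair ▸ hq pair hr)

/-! ### The one-visit equilibrium -/

open Classical in
/-- The receiver visits one sender, drawn from `w`, and garbles his offer to `pair`. If that is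
impossible, she learns nothing from him and visits the other sender. -/
noncomputable def oneVisitStrategy (ε : ℝ) (w : PMF (Fin 2)) (pair : Experiment μ)
    (Q : Experiment μ → ℝ → Experiment μ) (hQ : ∀ r x, IsGarbling (Q r x).law r.law)
    (hQm : ∀ r, Measurable fun x => (Q r x).law) : Strategy μ where
  order := some w
  garble₁ _ r := if IsGarbling pair.law r.law then pair else .noInfo pair.prior_mem
  garble₁_isGarbling i r := by
    split_ifs with h
    · exact h
    · exact Experiment.noInfo_isGarbling _ r
  -- The interval is open so that the draws `μ ± ε` of `pair` end the search.
  visit _ := Ioo (μ - ε) (μ + ε)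
  measurableSet_visit _ := measurableSet_Ioo
  garble₂ _ x r := Q r x
  garble₂_isGarbling _ x r := hQ r x
  measurable_garble₂ _ r := hQm r
  tie _ _ := 1
  measurable_tie _ := measurable_const
  idle := w

section OneVisit

variable {w : PMF (Fin 2)} {pair : Experiment μ} {Q : Experiment μ → ℝ → Experiment μ}
  {hQ : ∀ r x, IsGarbling (Q r x).law r.law} {hQm : ∀ r, Measurable fun x => (Q r x).law}

theorem outcomeFrom_oneVisit (hε : 0 < ε) (hpair : pair.law = twoPointLaw μ (μ - ε) (μ + ε))
    (p : Fin 2 → Experiment μ) (i : Fin 2) (hp : IsGarbling pair.law (p i).law) :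
    outcomeFrom p (oneVisitStrategy ε w pair Q hQ hQm) i =
      (2⁻¹ : ENNReal) • Measure.dirac (some i, beliefs i (μ - ε) μ, false, other i) +
        (2⁻¹ : ENNReal) • Measure.dirac (some i, beliefs i (μ + ε) μ, false, i) := by
  have h1 : (oneVisitStrategy ε w pair Q hQ hQm).garble₁ i (p i) = pair := if_pos hp
  rw [outcomeFrom, h1, hpair, bind_twoPointLaw_symm hε, if_neg, if_neg,
    Strategy.select_of_gt _ _ (by linarith), Strategy.select_of_lt _ _ (by linarith)]
  · exact fun h => lt_irrefl _ h.2
  · exact fun h => lt_irrefl _ h.1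

/-- Selection is a fair coin whichever sender the pair is drawn from. If the first offer does not
allow it, the optimal reply to the second offer at belief `μ` is forced to have the pair's law. -/
theorem outcomeFrom_oneVisit_selected (hk : 4 * k * ε = 1) (hε : 0 < ε)
    (hpair : pair.law = twoPointLaw μ (μ - ε) (μ + ε))
    (hQo : ∀ r x, ∀ q : Experiment μ, IsGarbling q.law r.law →
      stage2Payoff k x q ≤ stage2Payoff k x (Q r x))
    (p : Fin 2 → Experiment μ) (i j : Fin 2)
    (hp : IsGarbling pair.law (p j).law ∨ IsGarbling pair.law (p (other j)).law) :
    outcomeFrom p (oneVisitStrategy ε w pair Q hQ hQm) j {o | o.2.2.2 = i} = 2⁻¹ := by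
  have key : ∀ a b : Outcome, a.2.2.2 = other j → b.2.2.2 = j →
      ((2⁻¹ : ENNReal) • Measure.dirac a + (2⁻¹ : ENNReal) • Measure.dirac b)
        {o | o.2.2.2 = i} = 2⁻¹ := fun a b ha hb => by
    simp only [Measure.add_apply, Measure.smul_apply,
      Measure.dirac_apply' _ (measurableSet_selected i), smul_eq_mul]
    rcases eq_or_eq_other j i with rfl | rfl
    · simp [ha, hb, other_ne]
    · simp [ha, hb, (other_ne j).symm]
  by_cases h : IsGarbling pair.law (p j).law
  · rw [outcomeFrom_oneVisit hε hpair p j h]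
    exact key _ _ rfl rfl
  · have h2 := hp.resolve_left h
    have h1 : (oneVisitStrategy ε w pair Q hQ hQm).garble₁ j (p j) = .noInfo pair.prior_mem :=
      if_neg h
    have h3 := law_eq_of_stage2Payoff_eq hk hε
      (stage2Payoff_eq_at_prior hk hε hpair h2 (hQo (p (other j)) μ))
    rw [outcomeFrom, h1, Experiment.noInfo, bind_dirac_left, if_pos (by simp [oneVisitStrategy, hε])]
    change ((Q (p (other j)) μ).law.bind _) _ = _
    rw [h3, bind_twoPointLaw_symm hε, Strategy.select_of_lt _ _ (by linarith),
      Strategy.select_of_gt _ _ (by linarith), add_comm]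
    exact key _ _ rfl rfl

theorem senderPayoff_oneVisit (hk : 4 * k * ε = 1) (hε : 0 < ε)
    (hpair : pair.law = twoPointLaw μ (μ - ε) (μ + ε))
    (hQo : ∀ r x, ∀ q : Experiment μ, IsGarbling q.law r.law →
      stage2Payoff k x q ≤ stage2Payoff k x (Q r x))
    (p : Fin 2 → Experiment μ) (i : Fin 2)
    (hp : ∀ j, IsGarbling pair.law (p j).law ∨ IsGarbling pair.law (p (other j)).law) :
    senderPayoff p (oneVisitStrategy ε w pair Q hQ hQm) i = 2⁻¹ := by
  have e : outcome p (oneVisitStrategy ε w pair Q hQ hQm) =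
    ∑ j, w j • outcomeFrom p (oneVisitStrategy ε w pair Q hQ hQm) j := rfl
  rw [senderPayoff, measureReal_def, e, Measure.finsetSum_apply]
  simp_rw [Measure.smul_apply, outcomeFrom_oneVisit_selected hk hε hpair hQo p i _ (hp _),
    smul_eq_mul]
  rw [← Finset.sum_mul, sum_coe_pmf, one_mul]
  simp

theorem isEquilibrium_oneVisit (hk : 4 * k * ε = 1) (hε : 0 < ε)
    (hpair : pair.law = twoPointLaw μ (μ - ε) (μ + ε))
    (hQo : ∀ r x, ∀ q : Experiment μ, IsGarbling q.law r.law →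
      stage2Payoff k x q ≤ stage2Payoff k x (Q r x))
    (p : Fin 2 → Experiment μ) (hp : ∀ i, IsGarbling pair.law (p i).law) :
    IsEquilibrium k p (oneVisitStrategy ε w pair Q hQ hQm) := by
  set σ := oneVisitStrategy ε w pair Q hQ hQm with hσ
  have hvis : ∀ i x, x ∈ σ.visit i ↔ x ∈ Ioo (μ - ε) (μ + ε) := fun i x => Iff.rfl
  have hs1 : ∀ i r, stage1Payoff k σ (p (other i)) i (σ.garble₁ i r) = μ + ε / 4 := fun i r => by
    rw [stage1Payoff_eq_iff hk hε]
    by_cases h : IsGarbling pair.law r.law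
    · have h1 : σ.garble₁ i r = pair := if_pos h
      rw [h1, hpair, twoPointLaw_symm hε]
      simp only [ae_add_measure_iff]
      constructor
      all_goals
        refine Measure.ae_smul_measure ?_ _
        rw [ae_dirac_eq, Filter.eventually_pure, continuation, if_neg (by simp [hvis])]
      · rw [max_eq_right (by linarith)]; linear_combination -ε * hk
      · rw [max_eq_left (by linarith)]; ring
    · have h1 : σ.garble₁ i r = .noInfo pair.prior_mem := if_neg h
      rw [h1, Experiment.noInfo, ae_dirac_eq, Filter.eventually_pure, continuation,
        if_pos (by simp [hvis, hε])]
      exact stage2Payoff_eq_at_prior hk hε hpair (hp (other i)) (hQo (p (other i)) μ)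
  refine ⟨fun i x _ r q h => hQo r x q h, fun i x _ => ?_, fun i r q _ => ?_, fun o => ?_,
    fun i r => ?_⟩
  · rw [continuation]
    by_cases h : x ∈ σ.visit i
    · rw [if_pos h]
      refine max_le ?_ le_rfl
      rw [← stage2Payoff_noInfo (k := k) pair.prior_mem]
      exact hQo _ _ _ (Experiment.noInfo_isGarbling _ _)
    · rw [if_neg h]
      exact max_le le_rfl (stage2Payoff_le_max hk hε _ h)
  · rw [hs1]; exact stage1Payoff_le hk hε _ _ _ _
  · exact (orderPayoff_le hk hε p σ o).trans
      (orderPayoff_some p σ w fun i => hs1 i (p i)).ge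
  -- A deviator leaves the other offer intact, so `pair` is always a garbling of at least one of the
  -- two offers.
  · rw [hσ, senderPayoff_oneVisit hk hε hpair hQo p i fun j => .inl (hp j),
      senderPayoff_oneVisit hk hε hpair hQo _ i fun j => ?_]
    rcases eq_or_eq_other i j with rfl | rfl
    · exact .inr (by rw [Function.update_of_ne (other_ne _)]; exact hp _)
    · exact .inl (by rw [Function.update_of_ne (other_ne _)]; exact hp _)

end OneVisit

/-! ### Transfer of an equilibrium to full information -/

section Full

variable {p : Fin 2 → Experiment μ} {σ : Strategy μ}

open Classical in
/-- The strategy that responds to the offers `full` as `σ` responds to the offers `p`. -/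
noncomputable def Strategy.transfer (σ : Strategy μ) (p : Fin 2 → Experiment μ)
    (full : Experiment μ) (hfull : ∀ q : Experiment μ, IsGarbling q.law full.law) (ε : ℝ) :
    Strategy μ where
  order := σ.order
  garble₁ i r := if r = full then σ.garble₁ i (p i) else σ.garble₁ i r
  garble₁_isGarbling i r := by
    split_ifs with h
    · rw [h]; exact hfull _
    · exact σ.garble₁_isGarbling i r
  -- At beliefs off the path, stopping in this interval may be optimal against `p` but not against
  -- `full`. A visit never hurts, since nothing need be learned there, so it can be added.
  visit i := σ.visit i ∪ Ioo (μ - ε) (μ + ε)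
  measurableSet_visit i := (σ.measurableSet_visit i).union measurableSet_Ioo
  garble₂ := σ.garble₂
  garble₂_isGarbling := σ.garble₂_isGarbling
  measurable_garble₂ := σ.measurable_garble₂
  tie := σ.tie
  measurable_tie := σ.measurable_tie
  idle := σ.idle

variable {full : Experiment μ} {hfull : ∀ q : Experiment μ, IsGarbling q.law full.law}

/-- After any offer `r` the receiver can learn nothing from it and then draw `μ ± ε` from the other
sender, which already attains the bound. -/
theorem IsEquilibrium.stage1Payoff_eq (h : IsEquilibrium k p σ) (hk : 4 * k * ε = 1)
    (hε : 0 < ε) {pair : Experiment μ} (hpair : pair.law = twoPointLaw μ (μ - ε) (μ + ε))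
    (hp : ∀ i, IsGarbling pair.law (p i).law) (i : Fin 2) (r : Experiment μ) :
    stage1Payoff k σ (p (other i)) i (σ.garble₁ i r) = μ + ε / 4 := by
  refine le_antisymm (stage1Payoff_le hk hε _ _ _ _) ?_
  have h1 := h.garble₁_optimal i r _ (Experiment.noInfo_isGarbling pair.prior_mem r)
  have h2 := (le_max_right _ _).trans (h.visit_optimal i μ pair.prior_mem)
  rw [stage2Payoff_eq_at_prior hk hε hpair (hp (other i))
    (h.garble₂_optimal i μ pair.prior_mem (p (other i)))] at h2
  rw [stage1Payoff_noInfo] at h1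
  refine le_trans (le_of_eq ?_) (h2.trans h1)
  linear_combination (-ε / 4) * hk

/-- Where the first-stage payoff is maximal, the receiver treats the offers `p` and `full` of the
other sender alike. -/
theorem IsEquilibrium.transfer_of_tight (h : IsEquilibrium k p σ) (hk : 4 * k * ε = 1)
    (hε : 0 < ε) {i : Fin 2} {x : ℝ} (hx : x ∈ Icc (0 : ℝ) 1)
    (ht : continuation k σ (p (other i)) i x = x + k * (x - μ - ε) ^ 2) :
    continuation k (σ.transfer p full hfull ε) full i x = x + k * (x - μ - ε) ^ 2 ∧
      (x ∈ (σ.transfer p full hfull ε).visit i ↔ x ∈ σ.visit i) ∧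
      (x ∈ σ.visit i → (σ.garble₂ i x full).law = (σ.garble₂ i x (p (other i))).law) := by
  -- In the added interval stopping falls strictly short of the bound, so a tight belief there was
  -- already followed by a visit.
  have hv : x ∈ (σ.transfer p full hfull ε).visit i ↔ x ∈ σ.visit i := by
    refine ⟨fun h1 => ?_, fun h1 => .inl h1⟩
    by_contra h2
    rw [continuation, if_neg h2] at ht
    exact (max_lt_bound hk hε (h1.resolve_left h2)).ne ht
  by_cases h1 : x ∈ σ.visit i
  · rw [continuation, if_pos h1] at ht
    have h2 : stage2Payoff k x (σ.garble₂ i x full) = x + k * (x - μ - ε) ^ 2 :=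
      le_antisymm (stage2Payoff_le hk hε _ x)
        (ht ▸ h.garble₂_optimal i x hx full _ (hfull _))
    refine ⟨?_, hv, fun _ => ?_⟩
    · rw [continuation, if_pos (hv.2 h1)]; exact h2
    · rw [law_eq_of_stage2Payoff_eq hk hε h2, law_eq_of_stage2Payoff_eq hk hε ht]
  · refine ⟨?_, hv, fun h2 => absurd h2 h1⟩
    rw [continuation, if_neg h1] at ht
    rw [continuation, if_neg (hv.not.2 h1), ht]

theorem outcome_congr {p p' : Fin 2 → Experiment μ} {σ σ' : Strategy μ}
    (ho : σ.order = σ'.order) (hi : σ.idle = σ'.idle)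
    (h : ∀ i, outcomeFrom p σ i = outcomeFrom p' σ' i) : outcome p σ = outcome p' σ' := by
  rw [outcome, outcome, ho, hi]
  simp_rw [h]

/-- Stated for general offers to cover both the path and unilateral deviations. A deviation by the
second sender is discovered only on visiting him, so the first stage is still tight against `p
(other i)`. -/
theorem IsEquilibrium.outcomeFrom_transfer (h : IsEquilibrium k p σ) (hk : 4 * k * ε = 1)
    (hε : 0 < ε) {pair : Experiment μ} (hpair : pair.law = twoPointLaw μ (μ - ε) (μ + ε))
    (hp : ∀ i, IsGarbling pair.law (p i).law) {p' p'' : Fin 2 → Experiment μ} {i : Fin 2}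
    (h₁ : (σ.transfer p full hfull ε).garble₁ i (p'' i) = σ.garble₁ i (p' i))
    (h₂ : p'' (other i) = p' (other i) ∨ p'' (other i) = full ∧ p' (other i) = p (other i)) :
    outcomeFrom p' σ i = outcomeFrom p'' (σ.transfer p full hfull ε) i := by
  rw [outcomeFrom, outcomeFrom, h₁]
  refine Measure.bind_congr_right ?_
  have ht := (stage1Payoff_eq_iff hk hε _ _ _ _).1 (h.stage1Payoff_eq hk hε hpair hp i (p' i))
  filter_upwards [ht, (σ.garble₁ i (p' i)).ae_mem] with x hx hx01
  obtain ⟨-, hv, hl⟩ := h.transfer_of_tight (full := full) (hfull := hfull) hk hε hx01 hx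
  by_cases hxv : x ∈ σ.visit i
  · rw [if_pos hxv, if_pos (hv.2 hxv)]
    have e : (σ.garble₂ i x (p'' (other i))).law = (σ.garble₂ i x (p' (other i))).law := by
      rcases h₂ with e | ⟨e, e'⟩
      · rw [e]
      · rw [e, e', hl hxv]
    change _ = ((σ.garble₂ i x (p'' (other i))).law.bind fun y => σ.select i x y true)
    rw [e]
  · rw [if_neg hxv, if_neg (hv.not.2 hxv)]
    rfl

theorem IsEquilibrium.outcome_transfer (h : IsEquilibrium k p σ) (hk : 4 * k * ε = 1)
    (hε : 0 < ε) {pair : Experiment μ} (hpair : pair.law = twoPointLaw μ (μ - ε) (μ + ε))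
    (hp : ∀ i, IsGarbling pair.law (p i).law) :
    outcome p σ = outcome (fun _ => full) (σ.transfer p full hfull ε) :=
  outcome_congr rfl rfl fun _ => h.outcomeFrom_transfer hk hε hpair hp
    (if_pos rfl) (.inr ⟨rfl, rfl⟩)

/-- The receiver's first stage again attains the universal bound, and every deviation of a sender
has the same outcome law as the same deviation from `p`. -/
theorem IsEquilibrium.transfer (h : IsEquilibrium k p σ) (hk : 4 * k * ε = 1)
    (hε : 0 < ε) {pair : Experiment μ} (hpair : pair.law = twoPointLaw μ (μ - ε) (μ + ε))
    (hp : ∀ i, IsGarbling pair.law (p i).law) :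
    IsEquilibrium k (fun _ => full) (σ.transfer p full hfull ε) := by
  set τ := σ.transfer p full hfull ε with hτ
  have hs1 : ∀ i r, stage1Payoff k τ full i (τ.garble₁ i r) = μ + ε / 4 := fun i r => by
    obtain ⟨r', hr'⟩ : ∃ r', τ.garble₁ i r = σ.garble₁ i r' := by
      by_cases hr : r = full
      · exact ⟨p i, if_pos hr⟩
      · exact ⟨r, if_neg hr⟩
    rw [stage1Payoff_eq_iff hk hε, hr']
    filter_upwards [(stage1Payoff_eq_iff hk hε _ _ _ _).1 (h.stage1Payoff_eq hk hε hpair hp i r'),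
      (σ.garble₁ i r').ae_mem] with x hx hx01
    exact (h.transfer_of_tight hk hε hx01 hx).1
  refine ⟨h.garble₂_optimal, fun i x hx => ?_, fun i r q _ => ?_, fun o => ?_, fun i r => ?_⟩
  · have h0 : max x μ ≤ stage2Payoff k x (τ.garble₂ i x full) := by
      rw [← stage2Payoff_noInfo (k := k) pair.prior_mem]
      exact h.garble₂_optimal i x hx _ _ (Experiment.noInfo_isGarbling _ _)
    rw [continuation]
    by_cases h1 : x ∈ τ.visit i
    · rw [if_pos h1]
      exact max_le h0 le_rfl
    · rw [if_neg h1]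
      exact max_le le_rfl (stage2Payoff_le_max hk hε _ fun h2 => h1 (.inr h2))
  · rw [hs1]; exact stage1Payoff_le hk hε _ _ _ _
  -- Visiting nobody yields only `μ`, less than the `μ + ε / 4` that any order of visits yields.
  · obtain ⟨w, hw⟩ : ∃ w, σ.order = some w := by
      refine Option.ne_none_iff_exists'.1 fun hn => ?_
      have h1 := h.order_optimal (some (PMF.pure 0))
      rw [orderPayoff_some p σ _ fun _ => h.stage1Payoff_eq hk hε hpair hp _ _, hn] at h1
      change _ ≤ μ at h1
      linarith
    have hw' : τ.order = some w := hw
    rw [hw', orderPayoff_some _ τ w fun _ => hs1 _ full]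
    exact orderPayoff_le hk hε _ τ o
  -- Against `p`, offering `full` may be a deviation, but here it is none; this case is separate
  -- because the transferred strategy replies to `full` as `σ` does to `p i`.
  · by_cases hr : r = full
    · rw [hr, Function.update_eq_self i (fun _ : Fin 2 => full)]
    · have e : outcome (Function.update p i r) σ =
          outcome (Function.update (fun _ => full) i r) τ := by
        refine outcome_congr rfl rfl fun j => h.outcomeFrom_transfer hk hε hpair hp ?_ ?_
        · rcases eq_or_eq_other i j with rfl | rfl
          · simp only [Function.update_self]; exact if_neg hr
          · simp only [Function.update_of_ne (other_ne _)]; exact if_pos rfl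
        · by_cases hj : other j = i
          · left; rw [hj]; simp
          · right; simp [Function.update_of_ne hj]
      have h1 := h.sender_optimal i r
      rw [senderPayoff, senderPayoff, e, h.outcome_transfer (hfull := hfull) hk hε hpair hp] at h1
      exact h1

end Full

end Disclosure

theorem mainTheorem9 (k μ : ℝ) (hk : 1 / 2 < k)
    (hμ : μ ∈ Set.Icc (1 / (4 * k)) (1 - 1 / (4 * k)))
    (p : Fin 2 → Disclosure.Experiment μ)
    (hp : ∀ i, Disclosure.IsGarbling
      (Disclosure.twoPointLaw μ (μ - 1 / (4 * k)) (μ + 1 / (4 * k))) (p i).law) :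
    (∀ w : PMF (Fin 2), ∃ σ : Disclosure.Strategy μ,
      Disclosure.IsEquilibrium k p σ ∧
      Disclosure.IsEquilibrium k
        (fun _ => Disclosure.Experiment.full μ (Disclosure.mem_unit_of_mem hk hμ)) σ ∧
      Disclosure.outcome p σ = Disclosure.oneVisitOutcome μ (1 / (4 * k)) w ∧
      Disclosure.outcome
        (fun _ => Disclosure.Experiment.full μ (Disclosure.mem_unit_of_mem hk hμ)) σ =
        Disclosure.oneVisitOutcome μ (1 / (4 * k)) w) ∧
    (∀ σ : Disclosure.Strategy μ, Disclosure.IsEquilibrium k p σ →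
      ∃ τ : Disclosure.Strategy μ,
        Disclosure.IsEquilibrium k
          (fun _ => Disclosure.Experiment.full μ (Disclosure.mem_unit_of_mem hk hμ)) τ ∧
        Disclosure.outcome p σ = Disclosure.outcome
          (fun _ => Disclosure.Experiment.full μ (Disclosure.mem_unit_of_mem hk hμ)) τ) := by
  have hk0 : 0 < k := by linarith
  have hε : 0 < 1 / (4 * k) := by positivity
  have hkε : 4 * k * (1 / (4 * k)) = 1 := by field_simp
  have hμ01 := Disclosure.mem_unit_of_mem hk hμ
  obtain ⟨pair, hpair⟩ : ∃ q : Disclosure.Experiment μ,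
      q.law = Disclosure.twoPointLaw μ (μ - 1 / (4 * k)) (μ + 1 / (4 * k)) :=
    ⟨.twoPoint μ _ _ (by linarith [hμ.1]) (by linarith) (by linarith) (by linarith [hμ.2])
      (by linarith), rfl⟩
  have hfull := Disclosure.Experiment.isGarbling_full hμ01
  rw [← hpair] at hp
  refine ⟨fun w => ?_, fun σ h => ⟨σ.transfer p (.full μ hμ01) hfull (1 / (4 * k)),
    h.transfer hkε hε hpair hp, h.outcome_transfer hkε hε hpair hp⟩⟩
  choose Q hQ hQm hQo using
    Disclosure.exists_measurable_optimal_garbling (μ := μ) (k := k) hkε hε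
  refine ⟨Disclosure.oneVisitStrategy (1 / (4 * k)) w pair Q hQ hQm,
    Disclosure.isEquilibrium_oneVisit hkε hε hpair hQo p hp,
    Disclosure.isEquilibrium_oneVisit hkε hε hpair hQo _ fun _ => hfull pair, ?_, ?_⟩
  · exact Finset.sum_congr rfl fun i _ => congrArg (w i • ·)
      (Disclosure.outcomeFrom_oneVisit hε hpair p i (hp i))
  · exact Finset.sum_congr rfl fun i _ => congrArg (w i • ·)
      (Disclosure.outcomeFrom_oneVisit hε hpair _ i (hfull pair))
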